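/- For $\lambda\in(\frac12,1)$, $N\ge 1$ and a digit string $a=(a_0,\dots,a_{N-1})\in\{0,1\}^N$ put $$x_a(\lambda)=(1-\lambda)\sum_{n=0}^{N-1}a_n\lambda^n .$$ Let $A_N(\lambda)=\{x_a(\lambda): a\in\{0,1\}^N\}$, where points are taken with multiplicity, so that $A_N(\lambda)$ always has $2^N$ members, and for $s>0$ let $$R_2(s,\lambda,2^N)=\frac1{2^N}\,\#\Bigl\{(a,b)\in\{0,1\}^N\times\{0,1\}^N:\ a\ne b,\ |x_a(\lambda)-x_b(\lambda)|\le \frac{s}{2^N}\Bigr\}$$ be the pair correlation function of $A_N(\lambda)$. **Theorem.** Let $I=[\lambda_0,\lambda_1]\subset(\frac12,0.668)$ be a compact interval. Then there is a constant $C_1$, depending only on $I$, such that for all integers $N\ge 1$ and all real $s>0$ the function $\lambda\mapsto R_2(s,\lambda,2^N)$ is integrable on $I$ and $$\int_I R_2(s,\lambda,2^N)\,d\lambda\le C_1 s .$$ -/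

import Mathlib

open MeasureTheory

/-- The point `(1 - l) * ∑_{n < N} a_n l^n` with digits `a_n ∈ {0,1}`. As `a` ranges over all
digit strings, this is the family of the `2 ^ N` points of `A_N(l)`, taken with multiplicity. -/
noncomputable def bernoulliPoint (N : ℕ) (l : ℝ) (a : Fin N → Fin 2) : ℝ :=
  (1 - l) * ∑ n : Fin N, ((a n : ℕ) : ℝ) * l ^ (n : ℕ)

/-- The pair correlation function `R_2(s, l, 2^N)` of `A_N(l)`: `2^{-N}` times the number of
ordered pairs of different members of the family `A_N(l)` (points with multiplicity, so that
different digit strings representing the same real number are different members) at distance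
at most `s / 2^N`. -/
noncomputable def pairCorr (s l : ℝ) (N : ℕ) : ℝ :=
  (1 / 2 ^ N : ℝ) *
    (Set.ncard {p : (Fin N → Fin 2) × (Fin N → Fin 2) |
      p.1 ≠ p.2 ∧ |bernoulliPoint N l p.1 - bernoulliPoint N l p.2| ≤ s / 2 ^ N} : ℝ)

open MeasureTheory

/-! If two digit strings first differ at index `k`, their points differ in absolute value by `(1 -
λ) λ ^ k |F(λ)|`, with `F` a polynomial with coefficients in `{-1, 0, 1}` and constant term `1`. The
key fact is transversality (`signEval_transversal`): on `[1/2, 0.668]` such an `F` never has `|F|`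
and `|F'|` both below `1/10000`. Hence `|F| ≤ ρ` holds only on a set of measure `O(ρ)`, uniformly in
`F` (`exists_volume_signEval_le`). The integral is `2^{-N}` times the sum over pairs of the measure
of the parameters where they are close. At most `4^N 2^{-k}` pairs first differ at `k`, each
contributing `O(s 2^{-N} λ₀^{-k})`, so the total is `O(s) ∑ (2 λ₀)^{-k}`, which converges because
`λ₀ > 1/2`. Transversality is a finite computation: the parameter interval is covered by small
boxes, and at each rational centre a search over leading coefficients excludes `F` and `F'` being
both nearly zero. -/

/-! ### Polynomials with coefficients in {-1, 0, 1} and their derivatives. -/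

/-- The value at `x` of the polynomial with coefficient list `l`, constant term first. -/
noncomputable def signEval (x : ℝ) : List SignType → ℝ
  | [] => 0
  | b :: l => (b : ℝ) + x * signEval x l

/-- The derivative at `x` of the polynomial with coefficient list `l`. -/
noncomputable def signDeriv (x : ℝ) : List SignType → ℝ
  | [] => 0
  | _ :: l => signEval x l + x * signDeriv x l

/-- The second derivative at `x` of the polynomial with coefficient list `l`. -/
noncomputable def signDeriv₂ (x : ℝ) : List SignType → ℝ
  | [] => 0
  | _ :: l => 2 * signDeriv x l + x * signDeriv₂ x l

theorem hasDerivAt_signEval (l : List SignType) (x : ℝ) :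
    HasDerivAt (fun y => signEval y l) (signDeriv x l) x := by
  induction l with
  | nil => simpa [signEval, signDeriv] using hasDerivAt_const x (0 : ℝ)
  | cons b l ih =>
    have h := ((hasDerivAt_id x).mul ih).const_add (b : ℝ)
    simpa [signEval, signDeriv] using h

theorem hasDerivAt_signDeriv (l : List SignType) (x : ℝ) :
    HasDerivAt (fun y => signDeriv y l) (signDeriv₂ x l) x := by
  induction l with
  | nil => simpa [signDeriv, signDeriv₂] using hasDerivAt_const x (0 : ℝ)
  | cons b l ih =>
    have h := (hasDerivAt_signEval l x).add ((hasDerivAt_id x).mul ih)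
    refine h.congr_deriv ?_
    simp only [signDeriv₂, id]
    ring

theorem abs_signType_le_one (b : SignType) : |(b : ℝ)| ≤ 1 := by
  cases b <;> simp

theorem abs_signEval_le {x : ℝ} (h0 : 0 ≤ x) (h1 : x < 1) (l : List SignType) :
    |signEval x l| ≤ 1 / (1 - x) := by
  have hx : 0 < 1 - x := by linarith
  induction l with
  | nil => simp only [signEval, abs_zero]; positivity
  | cons b l ih =>
    calc |signEval x (b :: l)| ≤ |(b : ℝ)| + |x * signEval x l| := abs_add_le _ _
      _ ≤ 1 + x * (1 / (1 - x)) := by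
        rw [abs_mul, abs_of_nonneg h0]
        gcongr
        exact abs_signType_le_one b
      _ = 1 / (1 - x) := by field_simp; ring

theorem abs_signDeriv_le {x : ℝ} (h0 : 0 ≤ x) (h1 : x < 1) (l : List SignType) :
    |signDeriv x l| ≤ 1 / (1 - x) ^ 2 := by
  have hx : 0 < 1 - x := by linarith
  induction l with
  | nil => simp only [signDeriv, abs_zero]; positivity
  | cons b l ih =>
    calc |signDeriv x (b :: l)| ≤ |signEval x l| + |x * signDeriv x l| := abs_add_le _ _
      _ ≤ 1 / (1 - x) + x * (1 / (1 - x) ^ 2) := by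
        rw [abs_mul, abs_of_nonneg h0]
        gcongr
        exact abs_signEval_le h0 h1 l
      _ = 1 / (1 - x) ^ 2 := by field_simp; ring

theorem abs_signDeriv₂_le {x : ℝ} (h0 : 0 ≤ x) (h1 : x < 1) (l : List SignType) :
    |signDeriv₂ x l| ≤ 2 / (1 - x) ^ 3 := by
  have hx : 0 < 1 - x := by linarith
  induction l with
  | nil => simp only [signDeriv₂, abs_zero]; positivity
  | cons b l ih =>
    calc |signDeriv₂ x (b :: l)| ≤ |2 * signDeriv x l| + |x * signDeriv₂ x l| := abs_add_le _ _
      _ ≤ 2 * (1 / (1 - x) ^ 2) + x * (2 / (1 - x) ^ 3) := by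
        rw [abs_mul, abs_mul, abs_of_nonneg h0, abs_of_pos (two_pos : (0 : ℝ) < 2)]
        gcongr
        exact abs_signDeriv_le h0 h1 l
      _ = 2 / (1 - x) ^ 3 := by field_simp; ring

/-! ### Excluding a prescribed value and derivative by search. -/

/-- The sum `∑ i, |k - i| c ^ i`. -/
def tailWeight {𝕜 : Type*} [Field 𝕜] (c : 𝕜) : ℕ → 𝕜
  | 0 => c / (1 - c) ^ 2
  | k + 1 => (k + 1) + c * tailWeight c k

theorem tailWeight_cast (c : ℚ) (k : ℕ) :
    ((tailWeight c k : ℚ) : ℝ) = tailWeight (c : ℝ) k := by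
  induction k with
  | zero => simp [tailWeight]
  | succ k ih => simp [tailWeight, ih]

/-- The coefficient of `x ^ i` enters `k F(c) - c F'(c)` with weight `(k - i) c ^ i`, whence a bound
independent of the degree. Each `k` thus confines the attainable pairs `(F(c), F'(c))` to a strip;
the search prunes with these strips. -/
theorem abs_functional_le {c : ℝ} (h0 : 0 ≤ c) (h1 : c < 1) (k : ℕ) (l : List SignType) :
    |k * signEval c l - c * signDeriv c l| ≤ tailWeight c k := by
  have hx : 0 < 1 - c := by linarith
  induction k generalizing l with
  | zero =>
    have := mul_le_mul_of_nonneg_left (abs_signDeriv_le h0 h1 l) h0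
    simpa [tailWeight, abs_mul, abs_of_nonneg h0, div_eq_mul_inv] using this
  | succ k ih =>
    have step : ∀ (b : SignType) (l : List SignType),
        |((k + 1 : ℕ) : ℝ) * signEval c (b :: l) - c * signDeriv c (b :: l)|
          ≤ tailWeight c (k + 1) := by
      intro b l
      have e : ((k + 1 : ℕ) : ℝ) * signEval c (b :: l) - c * signDeriv c (b :: l)
          = (k + 1) * (b : ℝ) + c * (k * signEval c l - c * signDeriv c l) := by
        simp only [signEval, signDeriv]; push_cast; ring
      rw [e]
      calc _ ≤ |((k : ℝ) + 1) * (b : ℝ)| + |c * (k * signEval c l - c * signDeriv c l)| :=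
            abs_add_le _ _
        _ ≤ (k + 1) * 1 + c * tailWeight c k := by
          rw [abs_mul, abs_mul, abs_of_nonneg h0, abs_of_nonneg (by positivity : (0 : ℝ) ≤ k + 1)]
          gcongr
          · exact abs_signType_le_one b
          · exact ih l
        _ = _ := by simp [tailWeight]
    cases l with
    | cons b l => exact step b l
    -- The zero polynomial may be read as having constant term `0`.
    | nil => simpa [signEval, signDeriv] using step 0 []

/-- A search which, when it returns `true`, shows that no polynomial with coefficients in
`{-1, 0, 1}` has its value at `c` within `A` of `P` and its derivative at `c` within `B` of `Q`. -/
def refutes (c : ℚ) : ℕ → ℚ → ℚ → ℚ → ℚ → Bool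
  | 0, _, _, _, _ => false
  | n + 1, P, Q, A, B =>
    (List.range 9).any (fun k => decide (tailWeight c k + k * A + c * B < |k * P - c * Q|)) ||
    [(-1 : ℚ), 0, 1].all fun b =>
      refutes c n ((P - b) / c) ((Q - (P - b) / c) / c) (A / c) ((B + A / c) / c)

/-- Either some strip misses the whole box of radii `A`, `B` around `(P, Q)`, or the constant term
`b` is stripped off: from `F = b + x G` and `F' = G + x G'`, the target for `G(c)` is `(P - b) / c`
with error `A / c`, and this error also enters that of `G'(c)`. -/
theorem refutes_sound {c : ℚ} (h0 : 0 < c) (h1 : c < 1) {n : ℕ} {P Q A B : ℚ}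
    (h : refutes c n P Q A B = true) (l : List SignType)
    (hP : |signEval c l - P| ≤ A) (hQ : |signDeriv c l - Q| ≤ B) : False := by
  have h0' : (0 : ℝ) < c := by exact_mod_cast h0
  have h1' : (c : ℝ) < 1 := by exact_mod_cast h1
  induction n generalizing P Q A B l with
  | zero => simp [refutes] at h
  | succ n ih =>
    rw [refutes, Bool.or_eq_true, List.any_eq_true, List.all_eq_true] at h
    rcases h with ⟨k, -, hk⟩ | h
    · have hk' : tailWeight (c : ℝ) k + k * A + c * B < |(k : ℝ) * P - c * Q| := by
        rw [← tailWeight_cast]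
        exact_mod_cast of_decide_eq_true hk
      have e : (k : ℝ) * P - c * Q = (k * signEval c l - c * signDeriv c l)
          - k * (signEval c l - P) + c * (signDeriv c l - Q) := by ring
      have t1 := abs_functional_le h0'.le h1' k l
      have t2 : |(k : ℝ) * (signEval c l - P)| ≤ k * A := by
        rw [abs_mul, Nat.abs_cast]; gcongr
      have t3 : |(c : ℝ) * (signDeriv c l - Q)| ≤ c * B := by
        rw [abs_mul, abs_of_pos h0']; gcongr
      rw [e] at hk'
      have := abs_add_le ((k * signEval c l - c * signDeriv c l)
          - k * (signEval c l - P)) (c * (signDeriv c l - Q))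
      have := abs_sub (k * signEval c l - c * signDeriv c l) (k * (signEval c l - P))
      linarith
    · have step : ∀ (b : SignType) (l : List SignType), |signEval c (b :: l) - P| ≤ A →
          |signDeriv c (b :: l) - Q| ≤ B → False := by
        intro b l hP hQ
        have hb : ((b : ℚ)) ∈ [(-1 : ℚ), 0, 1] := by cases b <;> simp
        have e : signEval c l - (((P - b) / c : ℚ) : ℝ) = (signEval c (b :: l) - P) / c := by
          have : ((b : ℚ) : ℝ) = (b : ℝ) := by cases b <;> simp
          simp only [signEval]; push_cast; rw [this]; field_simp; ring
        have hP' : |signEval c l - (((P - b) / c : ℚ) : ℝ)| ≤ ((A / c : ℚ) : ℝ) := by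
          rw [e, abs_div, abs_of_pos h0']; push_cast; gcongr
        refine ih (h _ hb) l hP' ?_
        have e2 : signDeriv c l - (((Q - (P - b) / c) / c : ℚ) : ℝ)
            = ((signDeriv c (b :: l) - Q) - (signEval c l - (((P - b) / c : ℚ) : ℝ))) / c := by
          simp only [signDeriv]; push_cast; field_simp; ring
        rw [e2, abs_div, abs_of_pos h0']
        push_cast at hP' ⊢
        gcongr
        exact (abs_sub _ _).trans (add_le_add hQ hP')
      cases l with
      | cons b l => exact step b l hP hQ
      | nil => exact step 0 [] (by simpa [signEval] using hP) (by simpa [signEval, signDeriv] using hQ)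

/-! ### Box certificates and transversality. -/

/-- A test which, when it returns `true`, shows that no polynomial with coefficients in `{-1, 0, 1}`
and constant term `1` has both its value and its derivative below `1 / 10000` in absolute value
somewhere in the interval of radius `w` around `c`. -/
def boxCheck (c w : ℚ) : Bool :=
  -- The target `(0, 0)` after stripping the constant term `1`. The constant `56` bounds `|F''|` on
  -- `[0, 0.67]`, as `2 / 0.33 ^ 3 < 56`; it moves smallness from a point of the box to its centre.
  refutes c 30 (-1 / c) ((1 / c) / c)
    ((1 / 10000 + w * (1 / 10000 + 56 * w)) / c)
    ((1 / 10000 + 56 * w + (1 / 10000 + w * (1 / 10000 + 56 * w)) / c) / c)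

/-- Pairs `(c, w)` whose intervals `[c - w, c + w]` cover `[1/2, 0.668]`. -/
def certificateBoxes : List (ℚ × ℚ) :=
  [(6679 / 10000, 1 / 10000), (6676 / 10000, 2 / 10000), (6669 / 10000, 5 / 10000),
   (6657 / 10000, 7 / 10000), (6636 / 10000, 14 / 10000), (6608 / 10000, 14 / 10000),
   (6561 / 10000, 33 / 10000), (6484 / 10000, 44 / 10000), (6389 / 10000, 51 / 10000),
   (6210 / 10000, 128 / 10000), (5824 / 10000, 258 / 10000), (5138 / 10000, 428 / 10000)]

theorem boxCheck_certificateBoxes : (certificateBoxes.all fun p => boxCheck p.1 p.2) = true := by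
  decide +kernel

theorem abs_signDeriv₂_le_const {x : ℝ} (h0 : 0 ≤ x) (h1 : x ≤ 0.67) (l : List SignType) :
    |signDeriv₂ x l| ≤ 56 := by
  refine (abs_signDeriv₂_le h0 (by linarith) l).trans ?_
  have h : (0.33 : ℝ) ≤ 1 - x := by linarith
  calc 2 / (1 - x) ^ 3 ≤ 2 / (0.33 : ℝ) ^ 3 := by gcongr
    _ ≤ 56 := by norm_num

theorem abs_signDeriv_sub_le {x y : ℝ} (hx : x ∈ Set.Icc (0 : ℝ) 0.67)
    (hy : y ∈ Set.Icc (0 : ℝ) 0.67) (l : List SignType) :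
    |signDeriv y l - signDeriv x l| ≤ 56 * |y - x| :=
  (convex_Icc (0 : ℝ) 0.67).norm_image_sub_le_of_norm_hasDerivWithin_le
    (fun z _ => (hasDerivAt_signDeriv l z).hasDerivWithinAt)
    (fun _ hz => abs_signDeriv₂_le_const hz.1 hz.2 l) hx hy

/-- By the mean value inequality, passing from `x` to the centre changes `F'` by at most `56 w`, and
hence `F` by at most `w (1/10000 + 56 w)`; these are the tolerances built into the search. -/
theorem not_small_near_of_boxCheck {c w : ℚ} (hw : 0 ≤ w) (hc0 : 0 < c - w) (hc1 : c + w ≤ 0.67)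
    (h : boxCheck c w = true) (l : List SignType) {x : ℝ} (hx : |x - c| ≤ w)
    (hF : |signEval x (1 :: l)| < 1 / 10000) (hD : |signDeriv x (1 :: l)| < 1 / 10000) :
    False := by
  have hw' : (0 : ℝ) ≤ w := by exact_mod_cast hw
  have hc0' : (0 : ℝ) < c - w := by exact_mod_cast hc0
  have hc1' : (c : ℝ) + w ≤ 0.67 := by
    have : ((c + w : ℚ) : ℝ) ≤ ((0.67 : ℚ) : ℝ) := by exact_mod_cast hc1
    norm_num at this ⊢
    linarith
  have hcpos : (0 : ℝ) < c := by linarith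
  have hxc := abs_le.mp hx
  have near : ∀ z ∈ Set.Icc ((c : ℝ) - w) (c + w), z ∈ Set.Icc (0 : ℝ) 0.67 :=
    fun z hz => ⟨by linarith [hz.1], by linarith [hz.2]⟩
  have hxm : x ∈ Set.Icc ((c : ℝ) - w) (c + w) := ⟨by linarith, by linarith⟩
  have hcm : (c : ℝ) ∈ Set.Icc ((c : ℝ) - w) (c + w) := ⟨by linarith, by linarith⟩
  have hcx : |(c : ℝ) - x| ≤ w := by rwa [abs_sub_comm]
  have hDc : |signDeriv c (1 :: l)| ≤ 1 / 10000 + 56 * w := by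
    have h1 := abs_signDeriv_sub_le (near x hxm) (near c hcm) (1 :: l)
    have h2 := abs_sub_abs_le_abs_sub (signDeriv c (1 :: l)) (signDeriv x (1 :: l))
    linarith
  have hFc : |signEval c (1 :: l)| ≤ 1 / 10000 + w * (1 / 10000 + 56 * w) := by
    have hb : ∀ z ∈ Set.uIcc x (c : ℝ), ‖signDeriv z (1 :: l)‖ ≤ 1 / 10000 + 56 * w := by
      intro z hz
      have hzx : |z - x| ≤ w := (Set.abs_sub_left_of_mem_uIcc hz).trans hcx
      have hzm : z ∈ Set.Icc ((c : ℝ) - w) (c + w) := Set.uIcc_subset_Icc hxm hcm hz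
      have h1 := abs_signDeriv_sub_le (near x hxm) (near z hzm) (1 :: l)
      have h2 := abs_sub_abs_le_abs_sub (signDeriv z (1 :: l)) (signDeriv x (1 :: l))
      rw [Real.norm_eq_abs]
      linarith
    have h1 := (convex_uIcc x (c : ℝ)).norm_image_sub_le_of_norm_hasDerivWithin_le
      (fun z _ => (hasDerivAt_signEval (1 :: l) z).hasDerivWithinAt) hb
      Set.left_mem_uIcc Set.right_mem_uIcc
    rw [Real.norm_eq_abs, Real.norm_eq_abs] at h1
    have h2 := abs_sub_abs_le_abs_sub (signEval c (1 :: l)) (signEval x (1 :: l))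
    have h3 : (1 / 10000 + 56 * (w : ℝ)) * |(c : ℝ) - x| ≤ (1 / 10000 + 56 * w) * w := by gcongr
    linarith
  have hFl : |signEval c l - ((-1 / c : ℚ) : ℝ)|
      ≤ (((1 / 10000 + w * (1 / 10000 + 56 * w)) / c : ℚ) : ℝ) := by
    have e : signEval c l - ((-1 / c : ℚ) : ℝ) = signEval c (1 :: l) / c := by
      simp only [signEval, SignType.coe_one]; push_cast; field_simp; ring
    rw [e, abs_div, abs_of_pos hcpos]
    push_cast
    gcongr
  refine refutes_sound (c := c) (by exact_mod_cast hcpos) (by linarith) h l hFl ?_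
  have e : signDeriv c l - ((1 / c / c : ℚ) : ℝ)
      = (signDeriv c (1 :: l) - (signEval c l - ((-1 / c : ℚ) : ℝ))) / c := by
    simp only [signDeriv]; push_cast; field_simp; ring
  rw [e, abs_div, abs_of_pos hcpos]
  push_cast at hFl ⊢
  gcongr
  exact (abs_sub _ _).trans (add_le_add hDc hFl)

/-- Transversality: a polynomial with coefficients in `{-1, 0, 1}` and constant term `1` has no
approximate double zero in `[1/2, 0.668]`. -/
theorem signEval_transversal (l : List SignType) {x : ℝ} (hx : x ∈ Set.Icc (1 / 2 : ℝ) 0.668)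
    (hF : |signEval x (1 :: l)| < 1 / 10000) : 1 / 10000 ≤ |signDeriv x (1 :: l)| := by
  by_contra! hD
  have key : ∀ p ∈ certificateBoxes, 0 ≤ p.2 → 0 < p.1 - p.2 → p.1 + p.2 ≤ 0.67 →
      ¬ |x - p.1| ≤ p.2 := fun p hp h1 h2 h3 h4 =>
    not_small_near_of_boxCheck h1 h2 h3
      (List.all_eq_true.mp boxCheck_certificateBoxes p hp) l h4 hF hD
  simp only [certificateBoxes, List.forall_mem_cons, abs_le, not_and_or, not_le] at key
  norm_num at key
  obtain ⟨h1, h2⟩ := hx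
  norm_num at h1 h2
  -- The boxes run from right to left without gaps, so each one in turn forces `x` to lie to its
  -- left, until `x < 1/2`.
  obtain ⟨k1, k2, k3, k4, k5, k6, k7, k8, k9, k10, k11, k12⟩ := key
  have a1 := k1.resolve_right (by linarith)
  have a2 := k2.resolve_right (by linarith)
  have a3 := k3.resolve_right (by linarith)
  have a4 := k4.resolve_right (by linarith)
  have a5 := k5.resolve_right (by linarith)
  have a6 := k6.resolve_right (by linarith)
  have a7 := k7.resolve_right (by linarith)
  have a8 := k8.resolve_right (by linarith)
  have a9 := k9.resolve_right (by linarith)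
  have a10 := k10.resolve_right (by linarith)
  have a11 := k11.resolve_right (by linarith)
  rcases k12 with h | h <;> linarith

/-! ### Measure of the parameters where a polynomial is small. -/

/-- The interval is so short that `f'` varies by at most `δ / 2`. If `ρ < δ`, one point of the
sublevel set has `|f'| ≥ δ`, so `|f'| ≥ δ / 2` throughout the interval, and the mean value theorem
bounds the diameter by `2 ρ / (δ / 2)`. If `ρ ≥ δ`, the length bound `2` suffices. -/
theorem volume_le_of_transversal {f f' : ℝ → ℝ} {p q δ M ρ : ℝ} (hδ : 0 < δ)
    (hM : M * (q - p) ≤ δ / 2) (hM0 : 0 ≤ M) (hpq : q - p ≤ 2)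
    (hf : ∀ x ∈ Set.Icc p q, HasDerivAt f (f' x) x)
    (hf' : ∀ x ∈ Set.Icc p q, ∀ y ∈ Set.Icc p q, |f' y - f' x| ≤ M * |y - x|)
    (ht : ∀ x ∈ Set.Icc p q, |f x| < δ → δ ≤ |f' x|) :
    volume {x ∈ Set.Icc p q | |f x| ≤ ρ} ≤ ENNReal.ofReal (4 / δ * ρ) := by
  refine (Real.volume_le_diam _).trans (Metric.ediam_le ?_)
  rintro y ⟨hy, hfy⟩ z ⟨hz, hfz⟩
  rw [edist_dist, Real.dist_eq]
  refine ENNReal.ofReal_le_ofReal ?_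
  have hyz : |y - z| ≤ q - p := abs_le.mpr ⟨by linarith [hy.1, hz.2], by linarith [hy.2, hz.1]⟩
  rcases le_or_gt δ ρ with hρδ | hρδ
  · calc |y - z| ≤ 4 := by linarith
      _ = 4 / δ * δ := by field_simp
      _ ≤ 4 / δ * ρ := by gcongr
  · obtain ⟨ξ, hξ, hξe⟩ : ∃ ξ ∈ Set.uIcc z y, f y - f z = f' ξ * (y - z) := by
      rcases lt_trichotomy y z with h | h | h
      · obtain ⟨ξ, hξ, e⟩ := exists_hasDerivAt_eq_slope f f' h
          (fun t ht => (hf t ⟨hy.1.trans ht.1, ht.2.trans hz.2⟩).continuousAt.continuousWithinAt)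
          (fun t ht => hf t ⟨hy.1.trans ht.1.le, ht.2.le.trans hz.2⟩)
        refine ⟨ξ, Set.Icc_subset_uIcc' (Set.Ioo_subset_Icc_self hξ), ?_⟩
        have : z - y ≠ 0 := by linarith
        rw [e]; field_simp; ring
      · exact ⟨z, Set.left_mem_uIcc, by simp [h]⟩
      · obtain ⟨ξ, hξ, e⟩ := exists_hasDerivAt_eq_slope f f' h
          (fun t ht => (hf t ⟨hz.1.trans ht.1, ht.2.trans hy.2⟩).continuousAt.continuousWithinAt)
          (fun t ht => hf t ⟨hz.1.trans ht.1.le, ht.2.le.trans hy.2⟩)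
        refine ⟨ξ, Set.Icc_subset_uIcc (Set.Ioo_subset_Icc_self hξ), ?_⟩
        have : y - z ≠ 0 := by linarith
        rw [e]; field_simp
    have hξm : ξ ∈ Set.Icc p q := Set.uIcc_subset_Icc hz hy hξ
    have h1 := hf' z hz ξ hξm
    have h2 := ht z hz (hfz.trans_lt hρδ)
    have h3 : |ξ - z| ≤ |y - z| := Set.abs_sub_left_of_mem_uIcc hξ
    have h4 : M * |ξ - z| ≤ M * (q - p) := by gcongr; exact h3.trans hyz
    have h5 : |f' z| - |f' ξ| ≤ |f' ξ - f' z| := by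
      rw [abs_sub_comm]; exact abs_sub_abs_le_abs_sub _ _
    have h6 : δ / 2 ≤ |f' ξ| := by linarith
    have h7 : |f' ξ| * |y - z| ≤ 2 * ρ := by
      rw [← abs_mul, ← hξe]
      exact (abs_sub _ _).trans (by linarith)
    have h8 : δ / 2 * |y - z| ≤ 2 * ρ := le_trans (by gcongr) h7
    rw [div_mul_eq_mul_div, le_div_iff₀ hδ]
    linarith

theorem exists_volume_signEval_le : ∃ C : ℝ, 0 ≤ C ∧ ∀ (l : List SignType) (ρ : ℝ),
    volume {x ∈ Set.Icc (1 / 2 : ℝ) 0.668 | |signEval x (1 :: l)| ≤ ρ} ≤ ENNReal.ofReal (C * ρ) := by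
  -- Chosen so that `56 η ≤ (1/10000) / 2`; then `400000` pieces have total length `0.2 > 0.668 -
  -- 1/2`.
  set η : ℝ := 1 / 2000000 with hη
  refine ⟨400000 * (4 / (1 / 10000)), by norm_num, fun l ρ => ?_⟩
  set J : ℕ → Set ℝ := fun i => Set.Icc (1 / 2 + i * η) (min (1 / 2 + (i + 1) * η) 0.668) with hJ
  have hcover : {x ∈ Set.Icc (1 / 2 : ℝ) 0.668 | |signEval x (1 :: l)| ≤ ρ} ⊆
      ⋃ i ∈ Finset.range 400000, {x ∈ J i | |signEval x (1 :: l)| ≤ ρ} := by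
    rintro x ⟨hx, hxρ⟩
    have hx0 : 0 ≤ (x - 1 / 2) / η := div_nonneg (by linarith [hx.1]) (by norm_num [hη])
    have hfl := Nat.floor_le hx0
    have hlt := Nat.lt_floor_add_one ((x - 1 / 2) / η)
    have hx1 := hx.2
    norm_num [hη] at hx1 hfl hlt
    refine Set.mem_iUnion₂.mpr ⟨⌊(x - 1 / 2) / η⌋₊, ?_, ⟨?_, le_min ?_ hx.2⟩, hxρ⟩
    · rw [Finset.mem_range, Nat.floor_lt hx0, hη]
      norm_num
      linarith
    · norm_num [hη]; linarith
    · norm_num [hη]; linarith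
  have hpiece : ∀ i, volume {x ∈ J i | |signEval x (1 :: l)| ≤ ρ}
      ≤ ENNReal.ofReal (4 / (1 / 10000) * ρ) := by
    intro i
    have hpos : (0 : ℝ) ≤ i * η := by positivity
    have hsub : ∀ x ∈ J i, x ∈ Set.Icc (1 / 2 : ℝ) 0.668 := fun x hx =>
      ⟨by linarith [hx.1], hx.2.trans (min_le_right _ _)⟩
    have hsub' : ∀ x ∈ J i, x ∈ Set.Icc (0 : ℝ) 0.67 := fun x hx =>
      ⟨by linarith [(hsub x hx).1], by linarith [(hsub x hx).2]⟩
    have hlen : min (1 / 2 + ((i : ℝ) + 1) * η) 0.668 - (1 / 2 + i * η) ≤ 1 / 2000000 := by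
      have := min_le_left (1 / 2 + ((i : ℝ) + 1) * η) 0.668
      linarith
    refine volume_le_of_transversal (f' := fun x => signDeriv x (1 :: l)) (M := 56)
      (by norm_num) ?_ (by norm_num) ?_
      (fun x _ => hasDerivAt_signEval (1 :: l) x)
      (fun x hx y hy => abs_signDeriv_sub_le (hsub' x hx) (hsub' y hy) (1 :: l))
      (fun x hx h => signEval_transversal l (hsub x hx) h)
    · linarith
    · linarith
  calc _ ≤ volume (⋃ i ∈ Finset.range 400000, {x ∈ J i | |signEval x (1 :: l)| ≤ ρ}) :=
        measure_mono hcover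
    _ ≤ ∑ i ∈ Finset.range 400000, volume {x ∈ J i | |signEval x (1 :: l)| ≤ ρ} :=
        measure_biUnion_finset_le _ _
    _ ≤ ∑ i ∈ Finset.range 400000, ENNReal.ofReal (4 / (1 / 10000) * ρ) :=
        Finset.sum_le_sum fun i _ => hpiece i
    _ = ENNReal.ofReal (400000 * (4 / (1 / 10000)) * ρ) := by
        rw [Finset.sum_const, Finset.card_range, nsmul_eq_mul, mul_assoc,
          ENNReal.ofReal_mul (by norm_num)]
        norm_num

/-! ### Normalising the difference of two points. -/

theorem signEval_ofFn {N : ℕ} (g : Fin N → SignType) (x : ℝ) :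
    signEval x (List.ofFn g) = ∑ n, (g n : ℝ) * x ^ (n : ℕ) := by
  induction N with
  | zero => simp [signEval]
  | succ N ih =>
    rw [List.ofFn_succ, signEval, ih, Fin.sum_univ_succ, Finset.mul_sum]
    simp only [Fin.val_zero, pow_zero, mul_one, Fin.val_succ, pow_succ]
    congr 1
    exact Finset.sum_congr rfl fun n _ => by ring

theorem signEval_map_neg (l : List SignType) (x : ℝ) :
    signEval x (l.map (fun b => -b)) = -signEval x l := by
  induction l with
  | nil => simp [signEval]
  | cons b l ih =>
    rw [List.map_cons, signEval, ih, signEval, SignType.coe_neg]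
    ring

/-- The power of `x` before the first nonzero coefficient factors out; if that coefficient is `-1`,
all signs are flipped, which the absolute value does not see. -/
theorem exists_abs_sum_eq_signEval {N : ℕ} (g : Fin N → SignType) (k : Fin N)
    (h0 : ∀ i < k, g i = 0) (hk : g k ≠ 0) :
    ∃ l, ∀ x : ℝ, |∑ n, (g n : ℝ) * x ^ (n : ℕ)| = |x| ^ (k : ℕ) * |signEval x (1 :: l)| := by
  simp only [← signEval_ofFn]
  induction N with
  | zero => exact k.elim0
  | succ N ih =>
    simp only [List.ofFn_succ]
    cases k using Fin.cases with
    | zero =>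
      rcases h : g 0 with _ | _ | _
      · exact absurd h hk
      · refine ⟨(List.ofFn fun i : Fin N => g i.succ).map (fun b => -b), fun x => ?_⟩
        rw [signEval, signEval, signEval_map_neg, Fin.val_zero, pow_zero, one_mul, ← abs_neg]
        congr 1
        simp
        ring
      · exact ⟨List.ofFn fun i : Fin N => g i.succ, fun x => by simp⟩
    | succ k =>
      obtain ⟨l, hl⟩ := ih (fun i => g i.succ) k
        (fun i hi => h0 _ (Fin.succ_lt_succ_iff.mpr hi)) hk
      refine ⟨l, fun x => ?_⟩
      rw [signEval, h0 0 (Fin.succ_pos k), SignType.coe_zero, zero_add, abs_mul, hl, Fin.val_succ,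
        pow_succ]
      ring

theorem exists_abs_bernoulliPoint_sub_eq {N : ℕ} {a b : Fin N → Fin 2} {k : Fin N}
    (h0 : ∀ i < k, a i = b i) (hk : a k ≠ b k) :
    ∃ l, ∀ x : ℝ, |bernoulliPoint N x a - bernoulliPoint N x b|
      = |1 - x| * (|x| ^ (k : ℕ) * |signEval x (1 :: l)|) := by
  obtain ⟨l, hl⟩ := exists_abs_sum_eq_signEval
    (fun n => if a n = b n then (0 : SignType) else if a n = 1 then 1 else -1) k
    (fun i hi => by simp [h0 i hi]) (by simp only [hk, if_false]; split_ifs <;> decide)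
  refine ⟨l, fun x => ?_⟩
  rw [← hl, ← abs_mul, bernoulliPoint, bernoulliPoint, ← mul_sub, ← Finset.sum_sub_distrib]
  congr 2
  refine Finset.sum_congr rfl fun n _ => ?_
  rw [← sub_mul]
  congr 1
  generalize a n = u
  generalize b n = v
  fin_cases u <;> fin_cases v <;> simp

/-! ### Counting pairs by their first disagreement. -/

theorem exists_first_ne {N : ℕ} {α : Type*} {a b : Fin N → α} (h : a ≠ b) :
    ∃ k, (∀ i < k, a i = b i) ∧ a k ≠ b k := by
  classical
  have hne : ∃ k, a k ≠ b k := Function.ne_iff.mp h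
  obtain ⟨k, hk, hmin⟩ := (Finset.univ.filter fun k => a k ≠ b k).exists_min_image id
    (by simpa [Finset.Nonempty] using hne)
  refine ⟨k, fun i hi => ?_, by simpa using hk⟩
  by_contra hi'
  exact absurd (hmin i (by simpa using hi')) (not_le.mpr hi)

/-- Such a pair is determined by its first string and the digits of the second from index `k` on. -/
theorem card_agree_below_le (N : ℕ) (k : Fin N) :
    (Finset.univ.filter fun p : (Fin N → Fin 2) × (Fin N → Fin 2) =>
      ∀ i < k, p.1 i = p.2 i).card ≤ 2 ^ N * 2 ^ (N - k) := by
  have h := Finset.card_le_card_of_injOn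
    (s := Finset.univ.filter fun p : (Fin N → Fin 2) × (Fin N → Fin 2) => ∀ i < k, p.1 i = p.2 i)
    (t := (Finset.univ : Finset ((Fin N → Fin 2) × ({i : Fin N // k ≤ i} → Fin 2))))
    (fun p => (p.1, fun i => p.2 i)) (fun _ _ => Finset.mem_coe.mpr (Finset.mem_univ _)) ?_
  · refine h.trans (le_of_eq ?_)
    rw [Finset.card_univ, Fintype.card_prod, Fintype.card_fun, Fintype.card_fun, Fintype.card_fin,
      Fintype.card_fin, Fintype.card_subtype]
    congr 2
    have : (Finset.univ.filter fun i : Fin N => k ≤ i) = Finset.Ici k := by ext; simp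
    rw [this, Fin.card_Ici]
  · rintro ⟨a, b⟩ h1 ⟨a', b'⟩ h2 h
    simp only [Finset.coe_filter, Finset.mem_univ, true_and, Set.mem_ofPred_eq] at h1 h2
    simp only [Prod.mk.injEq] at h
    obtain ⟨rfl, h⟩ := h
    refine Prod.ext rfl (funext fun i => ?_)
    rcases lt_or_ge i k with hi | hi
    · exact (h1 i hi).symm.trans (h2 i hi)
    · exact congrFun h ⟨i, hi⟩

/-- Each pair is charged to every `k` below which it agrees, not only to its first disagreement;
since `c ≥ 0`, this overcount only increases the right-hand side. -/
theorem sum_offDiag_le {N : ℕ} (V : (Fin N → Fin 2) × (Fin N → Fin 2) → ℝ)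
    (c : Fin N → ℝ) (hc : ∀ k, 0 ≤ c k)
    (hV : ∀ p k, (∀ i < k, p.1 i = p.2 i) → p.1 k ≠ p.2 k → V p ≤ c k) :
    ∑ p with p.1 ≠ p.2, V p ≤ ∑ k : Fin N, 2 ^ N * 2 ^ (N - k) * c k := by
  calc ∑ p with p.1 ≠ p.2, V p
      ≤ ∑ p : (Fin N → Fin 2) × (Fin N → Fin 2),
          ∑ k, if ∀ i < k, p.1 i = p.2 i then c k else 0 := by
        rw [Finset.sum_filter]
        refine Finset.sum_le_sum fun p _ => ?_
        have hnn : ∀ k ∈ Finset.univ, 0 ≤ if ∀ i < k, p.1 i = p.2 i then c k else 0 :=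
          fun k _ => by split_ifs <;> simp [hc]
        split_ifs with h
        · obtain ⟨k, hk, hk'⟩ := exists_first_ne h
          refine (hV p k hk hk').trans ?_
          refine le_trans ?_ (Finset.single_le_sum hnn (Finset.mem_univ k))
          rw [if_pos hk]
        · exact Finset.sum_nonneg hnn
    _ = ∑ k, ∑ p : (Fin N → Fin 2) × (Fin N → Fin 2),
          if ∀ i < k, p.1 i = p.2 i then c k else 0 := Finset.sum_comm
    _ ≤ ∑ k : Fin N, 2 ^ N * 2 ^ (N - k) * c k := by
        refine Finset.sum_le_sum fun k _ => ?_
        rw [← Finset.sum_filter, Finset.sum_const, nsmul_eq_mul]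
        refine mul_le_mul_of_nonneg_right ?_ (hc k)
        exact_mod_cast card_agree_below_le N k

/-! ### Integrating the pair correlation. -/

theorem continuous_bernoulliPoint (N : ℕ) (a : Fin N → Fin 2) :
    Continuous fun l => bernoulliPoint N l a := by
  unfold bernoulliPoint
  fun_prop

theorem measurableSet_close (N : ℕ) (a b : Fin N → Fin 2) (r : ℝ) :
    MeasurableSet {l | |bernoulliPoint N l a - bernoulliPoint N l b| ≤ r} :=
  (isClosed_le ((continuous_bernoulliPoint N a).sub (continuous_bernoulliPoint N b)).abs
    continuous_const).measurableSet

theorem pairCorr_eq_sum_indicator (s l : ℝ) (N : ℕ) :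
    pairCorr s l N = (1 / 2 ^ N : ℝ) *
      ∑ p : (Fin N → Fin 2) × (Fin N → Fin 2) with p.1 ≠ p.2,
        {x | |bernoulliPoint N x p.1 - bernoulliPoint N x p.2| ≤ s / 2 ^ N}.indicator
          (1 : ℝ → ℝ) l := by
  classical
  rw [pairCorr]
  congr 1
  simp only [Set.indicator_apply, Set.mem_ofPred_eq, Pi.one_apply]
  rw [← Finset.sum_filter, Finset.sum_const, nsmul_eq_mul, mul_one, Finset.filter_filter,
    ← Set.ncard_coe_finset]
  simp

theorem integrableOn_pairCorr (s : ℝ) (N : ℕ) (u v : ℝ) :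
    IntegrableOn (fun l => pairCorr s l N) (Set.Icc u v) volume := by
  simp only [pairCorr_eq_sum_indicator]
  refine Integrable.const_mul (integrable_finsetSum _ fun p _ => ?_) _
  exact (integrable_const (1 : ℝ)).indicator (measurableSet_close N p.1 p.2 _)

theorem setIntegral_pairCorr (s : ℝ) (N : ℕ) (u v : ℝ) :
    ∫ l in Set.Icc u v, pairCorr s l N = (1 / 2 ^ N : ℝ) *
      ∑ p : (Fin N → Fin 2) × (Fin N → Fin 2) with p.1 ≠ p.2,
        (volume.restrict (Set.Icc u v)).real
          {x | |bernoulliPoint N x p.1 - bernoulliPoint N x p.2| ≤ s / 2 ^ N} := by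
  simp only [pairCorr_eq_sum_indicator]
  rw [integral_const_mul, integral_finsetSum]
  · congr 1
    exact Finset.sum_congr rfl fun p _ => integral_indicator_one (measurableSet_close N p.1 p.2 _)
  · exact fun p _ =>
      (integrable_const (1 : ℝ)).indicator (measurableSet_close N p.1 p.2 _)

/-- On `[u, v]` the factor `|1 - x| |x| ^ k` is at least `0.332 u ^ k`, where `0.332 = 1 - 0.668`,
so closeness of the points forces the normalised polynomial to be small. -/
theorem volume_close_le {C : ℝ} (hC0 : 0 ≤ C) (hC : ∀ (l : List SignType) (ρ : ℝ),
      volume {x ∈ Set.Icc (1 / 2 : ℝ) 0.668 | |signEval x (1 :: l)| ≤ ρ} ≤ ENNReal.ofReal (C * ρ))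
    {u v : ℝ} (hu : 1 / 2 < u) (hv : v < 0.668) {N : ℕ} {a b : Fin N → Fin 2} {k : Fin N}
    (h0 : ∀ i < k, a i = b i) (hk : a k ≠ b k) {r : ℝ} (hr : 0 ≤ r) :
    (volume.restrict (Set.Icc u v)).real
        {x | |bernoulliPoint N x a - bernoulliPoint N x b| ≤ r}
      ≤ C * (r / (0.332 * u ^ (k : ℕ))) := by
  obtain ⟨l, hl⟩ := exists_abs_bernoulliPoint_sub_eq h0 hk
  have hu0 : 0 < u := by linarith
  have hsub : {x | |bernoulliPoint N x a - bernoulliPoint N x b| ≤ r} ∩ Set.Icc u v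
      ⊆ {x ∈ Set.Icc (1 / 2 : ℝ) 0.668 |
          |signEval x (1 :: l)| ≤ r / (0.332 * u ^ (k : ℕ))} := by
    rintro x ⟨hx, hxu, hxv⟩
    refine ⟨⟨by linarith, by linarith⟩, ?_⟩
    rw [Set.mem_ofPred_eq, hl, ← mul_assoc] at hx
    rw [le_div_iff₀ (by positivity), mul_comm]
    refine le_trans ?_ hx
    have h1 : (0.332 : ℝ) ≤ |1 - x| := (by linarith : (0.332 : ℝ) ≤ 1 - x).trans (le_abs_self _)
    have h2 : u ≤ |x| := hxu.trans (le_abs_self _)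
    gcongr
  refine ENNReal.toReal_le_of_le_ofReal (by positivity) ?_
  rw [Measure.restrict_apply (measurableSet_close N a b r)]
  exact (measure_mono hsub).trans (hC l _)

theorem theorem2p1 (l₀ l₁ : ℝ) (h₀ : 1 / 2 < l₀) (h₀₁ : l₀ ≤ l₁) (h₁ : l₁ < 0.668) :
    ∃ C₁ : ℝ, ∀ N : ℕ, 1 ≤ N → ∀ s : ℝ, 0 < s →
      IntegrableOn (fun l : ℝ => pairCorr s l N) (Set.Icc l₀ l₁) volume ∧
        ∫ l in Set.Icc l₀ l₁, pairCorr s l N ≤ C₁ * s := by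
  obtain ⟨C, hC0, hC⟩ := exists_volume_signEval_le
  have hl0 : 0 < l₀ := by linarith
  set θ : ℝ := (2 * l₀)⁻¹ with hθ
  have hθ0 : 0 ≤ θ := by positivity
  have hθ1 : θ < 1 := inv_lt_one_of_one_lt₀ (by linarith)
  refine ⟨C / 0.332 * (1 - θ)⁻¹, fun N _ s hs => ⟨integrableOn_pairCorr s N l₀ l₁, ?_⟩⟩
  rw [setIntegral_pairCorr]
  have hsum := sum_offDiag_le
    (fun p : (Fin N → Fin 2) × (Fin N → Fin 2) => (volume.restrict (Set.Icc l₀ l₁)).real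
      {x | |bernoulliPoint N x p.1 - bernoulliPoint N x p.2| ≤ s / 2 ^ N})
    (fun k => C * (s / 2 ^ N / (0.332 * l₀ ^ (k : ℕ)))) (fun k => by positivity)
    (fun p k h0 hk => volume_close_le hC0 hC h₀ h₁ h0 hk (by positivity))
  calc _ ≤ (1 / 2 ^ N : ℝ) *
        ∑ k : Fin N, 2 ^ N * 2 ^ (N - k) * (C * (s / 2 ^ N / (0.332 * l₀ ^ (k : ℕ)))) := by
        gcongr
    _ = C / 0.332 * s * ∑ k : Fin N, θ ^ (k : ℕ) := by
        rw [Finset.mul_sum, Finset.mul_sum]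
        refine Finset.sum_congr rfl fun k _ => ?_
        -- With the truncated exponent split as a quotient, all powers of `2 ^ N` cancel and `(2
        -- l₀)^{-k}` remains.
        have h2 : (2 : ℝ) ^ (N - k : ℕ) = 2 ^ N / 2 ^ (k : ℕ) := by
          rw [pow_sub₀ _ two_ne_zero k.2.le, div_eq_mul_inv]
        rw [h2, hθ, inv_pow, mul_pow]
        field_simp
    _ ≤ C / 0.332 * s * (1 - θ)⁻¹ := by
        gcongr
        rw [Fin.sum_univ_eq_sum_range (fun k => θ ^ k), ← tsum_geometric_of_lt_one hθ0 hθ1]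
        exact (summable_geometric_of_lt_one hθ0 hθ1).sum_le_tsum _ fun k _ => by positivity
    _ = _ := by ring
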